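/- Let $(\alpha_n)_{n\ge 1}$ be any sequence with $\alpha_n\in(0,1)$. Put $\alpha_0=1$ and, for $n\ge 0$ and $0\le i\le n$, $\pi_i^n=\alpha_i\prod_{k=i+1}^n(1-\alpha_k)$, which defines a probability distribution $\pi^n$ on $\{0,\dots,n\}$. Define $d_{mn}$ for integers $m,n\ge -1$ recursively by $d_{-1,-1}=0$, $d_{-1,k}=d_{k,-1}=1$ for $k\ge 0$, and, for $m,n\ge 0$, $$d_{mn}=\min_{z}\ \sum_{i=0}^m\sum_{j=0}^n z_{ij}\,d_{i-1,j-1},$$ the minimum being over all transport plans between $\pi^m$ and $\pi^n$, i.e. all $z_{ij}\ge 0$ ($0\le i\le m$, $0\le j\le n$) with $\sum_{j=0}^n z_{ij}=\pi_i^m$ for every $i$ and $\sum_{i=0}^m z_{ij}=\pi_j^n$ for every $j$. Then there exist a map $T:C\to C$ on the unit cube $C=[0,1]^{\mathbb N}\subset\ell^\infty(\mathbb N)$ which is nonexpansive, i.e. $\|Tx-Ty\|_\infty\le\|x-y\|_\infty$ for all $x,y\in C$, and a Krasnosel'skii–Mann sequence $(x^n)_{n\ge 0}$ in $C$ for $T$,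 i.e. a sequence with $x^{n+1}=(1-\alpha_{n+1})x^n+\alpha_{n+1}Tx^n$ for all $n\ge 0$, such that $$\|x^m-x^n\|_\infty=d_{mn}\qquad\text{for all } m,n\ge 0.$$ -/

import Mathlib

open scoped ENNReal

noncomputable section

namespace KM

/-- The weights `π_i^n = α_i ∏_{k=i+1}^n (1 - α_k)`, with the convention `α_0 = 1`
(the value `α 0` of the given sequence is never used). -/
def weight (α : ℕ → ℝ) (n i : ℕ) : ℝ :=
  (if i = 0 then 1 else α i) * ∏ k ∈ Finset.Ioc i n, (1 - α k)

/-- The polytope `F^{mn}` of transport plans between `π^m` on `{0, …, m}` and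
`π^n` on `{0, …, n}`. -/
def plans (α : ℕ → ℝ) (m n : ℕ) : Set (Fin (m + 1) → Fin (n + 1) → ℝ) :=
  {z | (∀ i j, 0 ≤ z i j) ∧
    (∀ i, ∑ j, z i j = weight α m i) ∧
    (∀ j, ∑ i, z i j = weight α n j)}

/-- The recursive transport values with indices shifted by one:
`shiftedBound α a b = d_{a-1,b-1}`, so that the index `0` plays the role of `-1`. -/
def shiftedBound (α : ℕ → ℝ) : ℕ → ℕ → ℝ
  | 0, 0 => 0
  | 0, _ + 1 => 1
  | _ + 1, 0 => 1
  | m + 1, n + 1 =>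
    sInf ((fun z : Fin (m + 1) → Fin (n + 1) → ℝ =>
      ∑ i : Fin (m + 1), ∑ j : Fin (n + 1), z i j * shiftedBound α i j) '' plans α m n)
termination_by a b => a + b
decreasing_by
  have hi := i.isLt
  have hj := j.isLt
  omega

/-- The recursive optimal transport bound `d_{mn}` for `m, n ∈ ℕ`. -/
def bound (α : ℕ → ℝ) (m n : ℕ) : ℝ := shiftedBound α (m + 1) (n + 1)

/-- The cost `∑_{i ≤ m} ∑_{j ≤ n} z_{ij} d_{i-1,j-1}` of a transport plan. -/
def cost (α : ℕ → ℝ) {m n : ℕ} (z : Fin (m + 1) → Fin (n + 1) → ℝ) : ℝ :=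
  ∑ i : Fin (m + 1), ∑ j : Fin (n + 1), z i j * shiftedBound α i j

/-- `T : C → C` is nonexpansive for the norm of the ambient space. -/
def Nonexpansive {X : Type*} [NormedAddCommGroup X] {C : Set X} (T : C → C) : Prop :=
  ∀ x y : C, ‖(T x : X) - (T y : X)‖ ≤ ‖(x : X) - (y : X)‖

/-- `x` is a Krasnosel'skii–Mann sequence of `T` with parameters `α_1, α_2, …`. -/
def IsKMSequence {X : Type*} [NormedAddCommGroup X] [NormedSpace ℝ X] {C : Set X}
    (α : ℕ → ℝ) (T : C → C) (x : ℕ → C) : Prop :=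
  ∀ n : ℕ, (x (n + 1) : X) = (1 - α (n + 1)) • (x n : X) + α (n + 1) • (T (x n) : X)

/-- The unit cube `[0,1]^ℕ` in `ℓ^∞(ℕ)`. -/
def unitCube : Set (lp (fun _ : ℕ => ℝ) ∞) :=
  {x | ∀ k : ℕ, x k ∈ Set.Icc (0 : ℝ) 1}

theorem sum_weight (α : ℕ → ℝ) (n : ℕ) : ∑ i : Fin (n + 1), weight α n i = 1 := by
  rw [Fin.sum_univ_eq_sum_range (fun i => weight α n i)]
  induction n with
  | zero => simp [weight]
  | succ n ih =>
    rw [Finset.sum_range_succ]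
    have h : ∀ i ∈ Finset.range (n + 1),
        weight α (n + 1) i = (1 - α (n + 1)) * weight α n i := by
      intro i hi
      have hi' : i ≤ n := Nat.lt_succ_iff.mp (Finset.mem_range.mp hi)
      unfold weight
      rw [Finset.prod_Ioc_succ_top (by omega)]
      ring
    rw [Finset.sum_congr rfl h, ← Finset.mul_sum, ih]
    simp [weight]

theorem weight_nonneg {α : ℕ → ℝ} (hα : ∀ n : ℕ, 1 ≤ n → α n ∈ Set.Ioo (0 : ℝ) 1)
    (n i : ℕ) : 0 ≤ weight α n i := by
  unfold weight
  refine mul_nonneg ?_ (Finset.prod_nonneg fun k hk => ?_)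
  · split_ifs with h
    · norm_num
    · exact (hα i (by omega)).1.le
  · have := (hα k (by have := (Finset.mem_Ioc.mp hk).1; omega)).2
    linarith

theorem plans_nonempty {α : ℕ → ℝ} (hα : ∀ n : ℕ, 1 ≤ n → α n ∈ Set.Ioo (0 : ℝ) 1)
    (m n : ℕ) : (plans α m n).Nonempty := by
  refine ⟨fun i j => weight α m i * weight α n j, fun i j =>
    mul_nonneg (weight_nonneg hα _ _) (weight_nonneg hα _ _), fun i => ?_, fun j => ?_⟩
  · rw [← Finset.mul_sum, sum_weight, mul_one]
  · rw [← Finset.sum_mul, sum_weight, one_mul]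

theorem plans_isCompact (α : ℕ → ℝ) (m n : ℕ) : IsCompact (plans α m n) := by
  have hbox : IsCompact (Set.univ.pi fun i : Fin (m + 1) =>
      Set.univ.pi fun _ : Fin (n + 1) => Set.Icc (0 : ℝ) (weight α m i)) :=
    isCompact_univ_pi fun _ => isCompact_univ_pi fun _ => isCompact_Icc
  refine hbox.of_isClosed_subset ?_ ?_
  · have h1 : IsClosed {z : Fin (m + 1) → Fin (n + 1) → ℝ | ∀ i j, 0 ≤ z i j} := by
      simp only [Set.ofPred_forall]
      exact isClosed_iInter fun i => isClosed_iInter fun j =>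
        isClosed_le continuous_const (by fun_prop)
    have h2 : IsClosed {z : Fin (m + 1) → Fin (n + 1) → ℝ |
        ∀ i, ∑ j, z i j = weight α m i} := by
      simp only [Set.ofPred_forall]
      exact isClosed_iInter fun i => isClosed_eq (by fun_prop) continuous_const
    have h3 : IsClosed {z : Fin (m + 1) → Fin (n + 1) → ℝ |
        ∀ j, ∑ i, z i j = weight α n j} := by
      simp only [Set.ofPred_forall]
      exact isClosed_iInter fun i => isClosed_eq (by fun_prop) continuous_const
    exact h1.inter (h2.inter h3)
  · intro z hz i _ j _
    refine ⟨hz.1 i j, ?_⟩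
    rw [← hz.2.1 i]
    exact Finset.single_le_sum (f := fun j => z i j) (fun j _ => hz.1 i j) (Finset.mem_univ j)

/-- The infimum defining `d_{mn}` is a minimum. -/
theorem isLeast_bound {α : ℕ → ℝ} (hα : ∀ n : ℕ, 1 ≤ n → α n ∈ Set.Ioo (0 : ℝ) 1)
    (m n : ℕ) : IsLeast (cost α '' plans α m n) (bound α m n) := by
  have hc : Continuous (cost α : (Fin (m + 1) → Fin (n + 1) → ℝ) → ℝ) := by
    unfold cost
    fun_prop
  have h : bound α m n = sInf (cost α '' plans α m n) := by
    unfold bound cost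
    rw [shiftedBound]
  rw [h]
  exact ((plans_isCompact α m n).image hc).isLeast_sInf ((plans_nonempty hα m n).image _)

end KM

end

open scoped ENNReal

noncomputable section

namespace KM

/-! The array `shiftedBound` is a pseudometric with values in `[0,1]`: optimal plans can be glued
along a common marginal (`shiftedBound_triangle`). Kantorovich–Rubinstein duality then makes `bound
α m n` the supremum of `average α u m - average α u n` over `[0,1]`-valued `u` that are
`1`-Lipschitz for it (`exists_potential`, `average_sub_le`).

Take countably many such `u`, nearly optimal for every pair `(m, n)` at every precision, one per
coordinate of the cube. Let `x n` have coordinates `average α u n` and prescribe `T (x n)` to have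
coordinates `u (n + 1)`. Duality gives the distances, `average_succ` is the Krasnosel'skii–Mann
recursion, and the Lipschitz bound says that `T` is nonexpansive on the orbit. A McShane extension
in each coordinate defines `T` on the whole cube. -/

theorem weight_pos {α : ℕ → ℝ} (hα : ∀ n : ℕ, 1 ≤ n → α n ∈ Set.Ioo (0 : ℝ) 1)
    (n i : ℕ) : 0 < weight α n i := by
  unfold weight
  refine mul_pos ?_ (Finset.prod_pos fun k hk => ?_)
  · split_ifs with h
    · norm_num
    · exact (hα i (by omega)).1
  · have := (hα k (by have := (Finset.mem_Ioc.mp hk).1; omega)).2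
    linarith

theorem weight_succ {α : ℕ → ℝ} {n i : ℕ} (hi : i ≤ n) :
    weight α (n + 1) i = (1 - α (n + 1)) * weight α n i := by
  unfold weight
  rw [Finset.prod_Ioc_succ_top (by omega)]
  ring

theorem weight_self (α : ℕ → ℝ) (n : ℕ) : weight α (n + 1) (n + 1) = α (n + 1) := by
  simp [weight]

/-- The average `∑_{i ≤ n} π_i^n u_i`. -/
def average (α : ℕ → ℝ) (u : ℕ → ℝ) (n : ℕ) : ℝ := ∑ i : Fin (n + 1), weight α n i * u i

theorem average_succ (α u : ℕ → ℝ) (n : ℕ) :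
    average α u (n + 1) = (1 - α (n + 1)) * average α u n + α (n + 1) * u (n + 1) := by
  unfold average
  rw [Fin.sum_univ_castSucc, Finset.mul_sum]
  congr 1
  · refine Finset.sum_congr rfl fun i _ => ?_
    rw [Fin.val_castSucc, weight_succ (by omega)]
    ring
  · simp [weight_self]

/-! ### The recursive transport values form a pseudometric. -/

section Distance

variable {α : ℕ → ℝ}

theorem sum_sum_of_mem_plans {m n : ℕ} {z : Fin (m + 1) → Fin (n + 1) → ℝ}
    (hz : z ∈ plans α m n) : ∑ i, ∑ j, z i j = 1 := by
  rw [Finset.sum_congr rfl fun i _ => hz.2.1 i, sum_weight]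

theorem exists_plan_cost_eq (hα : ∀ n : ℕ, 1 ≤ n → α n ∈ Set.Ioo (0 : ℝ) 1) (m n : ℕ) :
    ∃ z ∈ plans α m n, cost α z = shiftedBound α (m + 1) (n + 1) :=
  (isLeast_bound hα m n).1

theorem shiftedBound_le_cost (hα : ∀ n : ℕ, 1 ≤ n → α n ∈ Set.Ioo (0 : ℝ) 1) {m n : ℕ}
    {z : Fin (m + 1) → Fin (n + 1) → ℝ} (hz : z ∈ plans α m n) :
    shiftedBound α (m + 1) (n + 1) ≤ cost α z :=
  (isLeast_bound hα m n).2 ⟨z, hz, rfl⟩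

theorem shiftedBound_mem_Icc (hα : ∀ n : ℕ, 1 ≤ n → α n ∈ Set.Ioo (0 : ℝ) 1) :
    ∀ a b : ℕ, shiftedBound α a b ∈ Set.Icc (0 : ℝ) 1
  | 0, 0 => by simp [shiftedBound]
  | 0, _ + 1 => by simp [shiftedBound]
  | _ + 1, 0 => by simp [shiftedBound]
  | m + 1, n + 1 => by
    obtain ⟨z, hz, he⟩ := exists_plan_cost_eq hα m n
    rw [← he]
    constructor
    · exact Finset.sum_nonneg fun i _ => Finset.sum_nonneg fun j _ =>
        mul_nonneg (hz.1 i j) (shiftedBound_mem_Icc hα i j).1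
    · rw [← sum_sum_of_mem_plans hz]
      exact Finset.sum_le_sum fun i _ => Finset.sum_le_sum fun j _ =>
        mul_le_of_le_one_right (hz.1 i j) (shiftedBound_mem_Icc hα i j).2
termination_by a b => a + b
decreasing_by all_goals (have hi := i.isLt; have hj := j.isLt; omega)

theorem shiftedBound_self (hα : ∀ n : ℕ, 1 ≤ n → α n ∈ Set.Ioo (0 : ℝ) 1) (a : ℕ) :
    shiftedBound α a a = 0 := by
  induction a using Nat.strong_induction_on with
  | _ a ih =>
  cases a with
  | zero => simp [shiftedBound]
  | succ m =>
    refine le_antisymm ?_ (shiftedBound_mem_Icc hα _ _).1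
    have hz : (fun i j : Fin (m + 1) => if i = j then weight α m i else 0) ∈ plans α m m := by
      refine ⟨fun i j => ?_, fun i => by simp, fun j => by simp⟩
      dsimp only
      split_ifs
      exacts [weight_nonneg hα _ _, le_rfl]
    refine (shiftedBound_le_cost hα hz).trans_eq ?_
    refine Finset.sum_eq_zero fun i _ => Finset.sum_eq_zero fun j _ => ?_
    dsimp only
    split_ifs with h
    · rw [h, ih j j.isLt, mul_zero]
    · rw [zero_mul]

theorem shiftedBound_comm_le (hα : ∀ n : ℕ, 1 ≤ n → α n ∈ Set.Ioo (0 : ℝ) 1) :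
    ∀ a b : ℕ, shiftedBound α a b ≤ shiftedBound α b a
  | 0, 0 => le_rfl
  | 0, _ + 1 => by simp [shiftedBound]
  | _ + 1, 0 => by simp [shiftedBound]
  | m + 1, n + 1 => by
    obtain ⟨z, hz, he⟩ := exists_plan_cost_eq hα n m
    have hz' : (fun i j => z j i) ∈ plans α m n := ⟨fun i j => hz.1 j i, hz.2.2, hz.2.1⟩
    refine (shiftedBound_le_cost hα hz').trans ?_
    rw [← he]
    unfold cost
    rw [Finset.sum_comm]
    exact Finset.sum_le_sum fun i _ => Finset.sum_le_sum fun j _ =>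
      mul_le_mul_of_nonneg_left (shiftedBound_comm_le hα j i) (hz.1 i j)
termination_by a b => a + b
decreasing_by all_goals (have hi := i.isLt; have hj := j.isLt; omega)

theorem shiftedBound_comm (hα : ∀ n : ℕ, 1 ≤ n → α n ∈ Set.Ioo (0 : ℝ) 1) (a b : ℕ) :
    shiftedBound α a b = shiftedBound α b a :=
  le_antisymm (shiftedBound_comm_le hα a b) (shiftedBound_comm_le hα b a)

/-- Two plans with a common marginal `π^n` glued along it. -/
def glue (α : ℕ → ℝ) {m n p : ℕ} (z : Fin (m + 1) → Fin (n + 1) → ℝ)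
    (w : Fin (n + 1) → Fin (p + 1) → ℝ) (i : Fin (m + 1)) (k : Fin (p + 1)) : ℝ :=
  ∑ j, z i j * w j k / weight α n j

theorem sum_glue_left (hα : ∀ n : ℕ, 1 ≤ n → α n ∈ Set.Ioo (0 : ℝ) 1) {m n p : ℕ}
    {z : Fin (m + 1) → Fin (n + 1) → ℝ} {w : Fin (n + 1) → Fin (p + 1) → ℝ}
    (hw : w ∈ plans α n p) (i : Fin (m + 1)) (j : Fin (n + 1)) :
    ∑ k, z i j * w j k / weight α n j = z i j := by
  rw [← Finset.sum_div, ← Finset.mul_sum, hw.2.1, mul_div_cancel_right₀ _ (weight_pos hα n j).ne']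

theorem sum_glue_right (hα : ∀ n : ℕ, 1 ≤ n → α n ∈ Set.Ioo (0 : ℝ) 1) {m n p : ℕ}
    {z : Fin (m + 1) → Fin (n + 1) → ℝ} {w : Fin (n + 1) → Fin (p + 1) → ℝ}
    (hz : z ∈ plans α m n) (j : Fin (n + 1)) (k : Fin (p + 1)) :
    ∑ i, z i j * w j k / weight α n j = w j k := by
  rw [← Finset.sum_div, ← Finset.sum_mul, hz.2.2, mul_div_cancel_left₀ _ (weight_pos hα n j).ne']

theorem glue_mem_plans (hα : ∀ n : ℕ, 1 ≤ n → α n ∈ Set.Ioo (0 : ℝ) 1) {m n p : ℕ}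
    {z : Fin (m + 1) → Fin (n + 1) → ℝ} {w : Fin (n + 1) → Fin (p + 1) → ℝ}
    (hz : z ∈ plans α m n) (hw : w ∈ plans α n p) : glue α z w ∈ plans α m p := by
  refine ⟨fun i k => Finset.sum_nonneg fun j _ =>
    div_nonneg (mul_nonneg (hz.1 i j) (hw.1 j k)) (weight_nonneg hα _ _), fun i => ?_, fun k => ?_⟩
  · unfold glue
    rw [Finset.sum_comm, Finset.sum_congr rfl fun j _ => sum_glue_left hα hw i j, hz.2.1]
  · unfold glue
    rw [Finset.sum_comm, Finset.sum_congr rfl fun j _ => sum_glue_right hα hz j k, hw.2.2]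

/-- Gluing optimal plans (possible since all weights are positive) gives a competitor whose cost
splits by induction. If exactly one outer index or only the middle one is `0`, a term on the right
is already `1`. -/
theorem shiftedBound_triangle (hα : ∀ n : ℕ, 1 ≤ n → α n ∈ Set.Ioo (0 : ℝ) 1) :
    ∀ a b c : ℕ, shiftedBound α a c ≤ shiftedBound α a b + shiftedBound α b c
  | 0, 0, c => by simp [shiftedBound]
  | a, 0, 0 => by simp [shiftedBound]
  | 0, b + 1, c => by
    have h1 := shiftedBound_mem_Icc hα 0 c
    have h2 := shiftedBound_mem_Icc hα (b + 1) c
    have h3 : shiftedBound α 0 (b + 1) = 1 := by simp [shiftedBound]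
    linarith [h1.2, h2.1]
  | a, b + 1, 0 => by
    have h1 := shiftedBound_mem_Icc hα a 0
    have h2 := shiftedBound_mem_Icc hα a (b + 1)
    have h3 : shiftedBound α (b + 1) 0 = 1 := by simp [shiftedBound]
    linarith [h1.2, h2.1]
  | a + 1, 0, c => by
    have h1 := shiftedBound_mem_Icc hα (a + 1) c
    have h2 := shiftedBound_mem_Icc hα 0 c
    have h3 : shiftedBound α (a + 1) 0 = 1 := by simp [shiftedBound]
    linarith [h1.2, h2.1]
  | m + 1, n + 1, p + 1 => by
    obtain ⟨z, hz, hez⟩ := exists_plan_cost_eq hα m n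
    obtain ⟨w, hw, hew⟩ := exists_plan_cost_eq hα n p
    refine (shiftedBound_le_cost hα (glue_mem_plans hα hz hw)).trans ?_
    have h1 : cost α z =
        ∑ i, ∑ k, ∑ j, z i j * w j k / weight α n j * shiftedBound α i j := by
      refine Finset.sum_congr rfl fun i _ => ?_
      rw [Finset.sum_comm]
      refine Finset.sum_congr rfl fun j _ => ?_
      rw [← Finset.sum_mul, sum_glue_left hα hw]
    have h2 : cost α w =
        ∑ i, ∑ k, ∑ j, z i j * w j k / weight α n j * shiftedBound α j k := by
      rw [Finset.sum_comm]
      unfold cost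
      rw [Finset.sum_comm]
      refine Finset.sum_congr rfl fun k _ => ?_
      rw [Finset.sum_comm]
      refine Finset.sum_congr rfl fun j _ => ?_
      rw [← Finset.sum_mul, sum_glue_right hα hz]
    rw [← hez, ← hew, h1, h2, ← Finset.sum_add_distrib]
    refine Finset.sum_le_sum fun i _ => ?_
    rw [← Finset.sum_add_distrib]
    refine Finset.sum_le_sum fun k _ => ?_
    rw [← Finset.sum_add_distrib, glue, Finset.sum_mul]
    refine Finset.sum_le_sum fun j _ => ?_
    rw [← mul_add]
    exact mul_le_mul_of_nonneg_left (shiftedBound_triangle hα i j k)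
      (div_nonneg (mul_nonneg (hz.1 i j) (hw.1 j k)) (weight_nonneg hα _ _))
termination_by a b c => a + b + c
decreasing_by all_goals (have hi := i.isLt; have hj := j.isLt; have hk := k.isLt; omega)

end Distance

/-! ### Kantorovich duality by separation of convex sets. -/

section Duality

/-- Approximate Kantorovich duality for finitely supported probability measures. -/
theorem exists_dual_potentials {ι κ : Type*} [Fintype ι] [Fintype κ] (a : ι → ℝ) (b : κ → ℝ)
    (c : ι → κ → ℝ) (W : ℝ)
    (hne : ∃ z : ι → κ → ℝ, (∀ i j, 0 ≤ z i j) ∧ (∀ i, ∑ j, z i j = a i) ∧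
      (∀ j, ∑ i, z i j = b j) ∧ ∑ i, ∑ j, z i j * c i j = W)
    (hsum : ∑ i, a i = 1)
    (hW : ∀ z : ι → κ → ℝ, (∀ i j, 0 ≤ z i j) → (∀ i, ∑ j, z i j = a i) →
      (∀ j, ∑ i, z i j = b j) → W ≤ ∑ i, ∑ j, z i j * c i j) {ε : ℝ} (hε : 0 < ε) :
    ∃ (f : ι → ℝ) (g : κ → ℝ), (∀ i j, f i ≤ g j + c i j) ∧
      W - ε = ∑ i, a i * f i - ∑ j, b j * g j := by
  classical
  let L : (ι × κ → ℝ) →ₗ[ℝ] (ι → ℝ) × (κ → ℝ) × ℝ :=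
    { toFun := fun z => (fun i => ∑ j, z (i, j), fun j => ∑ i, z (i, j),
        ∑ i, ∑ j, z (i, j) * c i j)
      map_add' := fun z w => by
        ext <;> simp [Finset.sum_add_distrib, add_mul]
      map_smul' := fun r z => by
        ext <;> simp [Finset.mul_sum, mul_assoc] }
  have hL : ∀ z, L z = (fun i => ∑ j, z (i, j), fun j => ∑ i, z (i, j),
        ∑ i, ∑ j, z (i, j) * c i j) := fun _ => rfl
  obtain ⟨z₀, hz₀, hza, hzb, hzW⟩ := hne
  -- `L` records marginals and cost. The gap `ε` keeps its compact image off the closed set of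
  -- triples with marginals `a`, `b` and cost at most `W - ε`.
  have hA : IsCompact (L '' stdSimplex ℝ (ι × κ)) :=
    (isCompact_stdSimplex ℝ (ι × κ)).image L.continuous_of_finiteDimensional
  have hAc : Convex ℝ (L '' stdSimplex ℝ (ι × κ)) := (convex_stdSimplex ℝ _).linear_image L
  have hB : IsClosed (({a} : Set (ι → ℝ)) ×ˢ ({b} : Set (κ → ℝ)) ×ˢ Set.Iic (W - ε)) :=
    isClosed_singleton.prod (isClosed_singleton.prod isClosed_Iic)
  have hBc : Convex ℝ (({a} : Set (ι → ℝ)) ×ˢ ({b} : Set (κ → ℝ)) ×ˢ Set.Iic (W - ε)) :=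
    (convex_singleton a).prod ((convex_singleton b).prod (convex_Iic _))
  have hdisj : Disjoint (L '' stdSimplex ℝ (ι × κ))
      (({a} : Set (ι → ℝ)) ×ˢ ({b} : Set (κ → ℝ)) ×ˢ Set.Iic (W - ε)) := by
    rw [Set.disjoint_left]
    rintro _ ⟨z, hz, rfl⟩ ⟨h1, h2, h3⟩
    have := hW (fun i j => z (i, j)) (fun i j => hz.1 (i, j)) (fun i => congrFun h1 i)
      (fun j => congrFun h2 j)
    have h3' : ∑ i, ∑ j, z (i, j) * c i j ≤ W - ε := h3
    linarith
  obtain ⟨F, u, v, hu, huv, hv⟩ := geometric_hahn_banach_compact_closed hAc hA hBc hB hdisj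
  set φ : ι → ℝ := fun i => F (Pi.single i 1, 0, 0) with hφ
  set ψ : κ → ℝ := fun j => F (0, Pi.single j 1, 0) with hψ
  set μ : ℝ := F (0, 0, 1) with hμ
  have hF : ∀ r s t, F (r, s, t) = ∑ i, r i * φ i + ∑ j, s j * ψ j + t * μ := by
    intro r s t
    have h1 : F (r, 0, 0) = ∑ i, r i * φ i := by
      have := LinearMap.pi_apply_eq_sum_univ
        ((F : _ →ₗ[ℝ] ℝ) ∘ₗ LinearMap.inl ℝ (ι → ℝ) ((κ → ℝ) × ℝ)) r
      simp only [LinearMap.comp_apply, LinearMap.inl_apply, smul_eq_mul] at this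
      refine this.trans (Finset.sum_congr rfl fun i _ => ?_)
      refine congrArg (fun v => r i * F (v, 0, 0)) (funext fun k => ?_)
      simp [Pi.single_apply, eq_comm]
    have h2 : F (0, s, 0) = ∑ j, s j * ψ j := by
      have := LinearMap.pi_apply_eq_sum_univ
        ((F : _ →ₗ[ℝ] ℝ) ∘ₗ LinearMap.inr ℝ (ι → ℝ) ((κ → ℝ) × ℝ) ∘ₗ LinearMap.inl ℝ (κ → ℝ) ℝ) s
      simp only [LinearMap.comp_apply, LinearMap.inl_apply, LinearMap.inr_apply,
        smul_eq_mul] at this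
      refine this.trans (Finset.sum_congr rfl fun j _ => ?_)
      refine congrArg (fun v => s j * F (0, v, 0)) (funext fun k => ?_)
      simp [Pi.single_apply, eq_comm]
    have h3 : F (0, 0, t) = t * μ := by
      rw [hμ, ← smul_eq_mul, ← map_smul]
      simp
    rw [← h1, ← h2, ← h3, ← map_add, ← map_add]
    simp
  have hz₀mem : (fun q : ι × κ => z₀ q.1 q.2) ∈ stdSimplex ℝ (ι × κ) := by
    refine ⟨fun q => hz₀ q.1 q.2, ?_⟩
    rw [Fintype.sum_prod_type, ← hsum]
    exact Finset.sum_congr rfl fun i _ => hza i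
  have hup := hu _ ⟨_, hz₀mem, rfl⟩
  have hlow := hv (a, b, W - ε) ⟨rfl, rfl, le_refl (W - ε)⟩
  have e0 : L (fun q : ι × κ => z₀ q.1 q.2) = (a, b, W) := by
    rw [hL]
    exact Prod.ext (funext hza) (Prod.ext (funext hzb) hzW)
  rw [e0] at hup
  rw [hF] at hup hlow
  -- The points compared, `(a, b, W)` and `(a, b, W - ε)`, differ only in cost, so separation forces
  -- `ε * μ < 0`.
  have hneg : μ < 0 := by nlinarith
  -- Separation at the vertices of the simplex; dividing by `μ < 0` turns it into the dual
  -- constraint.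
  have key : ∀ i j, φ i + ψ j + c i j * μ <
      ∑ i, a i * φ i + ∑ j, b j * ψ j + (W - ε) * μ := by
    intro i j
    have hmem : (Pi.single (i, j) 1 : ι × κ → ℝ) ∈ stdSimplex ℝ (ι × κ) :=
      single_mem_stdSimplex ℝ (i, j)
    have h := hu _ ⟨_, hmem, rfl⟩
    have e : L (Pi.single (i, j) 1) = (Pi.single i 1, Pi.single j 1, c i j) := by
      rw [hL]
      refine Prod.ext (funext fun k => ?_) (Prod.ext (funext fun k => ?_) ?_)
      · simp [Pi.single_apply, Prod.ext_iff, ite_and, eq_comm]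
      · simp [Pi.single_apply, Prod.ext_iff, ite_and, eq_comm]
      · simp [Pi.single_apply, Prod.ext_iff, ite_and]
    rw [e, hF] at h
    simp [Pi.single_apply] at h
    linarith
  set K : ℝ := ∑ i, a i * φ i + ∑ j, b j * ψ j + (W - ε) * μ with hK
  refine ⟨fun i => (K - φ i) / μ, fun j => ψ j / μ, fun i j => ?_, ?_⟩
  · have h := key i j
    rw [← sub_le_iff_le_add', ← sub_div, div_le_iff_of_neg hneg]
    linarith
  · have h1 : ∑ i, a i * ((K - φ i) / μ) = (K - ∑ i, a i * φ i) / μ := by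
      rw [sub_div, Finset.sum_div]
      simp only [sub_div, mul_sub, Finset.sum_sub_distrib, ← Finset.sum_mul, hsum, one_mul,
        mul_div_assoc]
    have h2 : ∑ j, b j * (ψ j / μ) = (∑ j, b j * ψ j) / μ := by
      rw [Finset.sum_div]
      simp only [mul_div_assoc]
    rw [h1, h2, ← sub_div, eq_div_iff hneg.ne, hK]
    ring

end Duality

/-! ### Lipschitz potentials and their averages. -/

section Potential

variable {α : ℕ → ℝ}

/-- Approximate Kantorovich–Rubinstein potentials with values in `[0,1]`, defined on all indices. -/
theorem exists_potential (hα : ∀ n : ℕ, 1 ≤ n → α n ∈ Set.Ioo (0 : ℝ) 1) (m n : ℕ)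
    {ε : ℝ} (hε : 0 < ε) :
    ∃ u : ℕ → ℝ, (∀ i, u i ∈ Set.Icc (0 : ℝ) 1) ∧
      (∀ i j, u i ≤ u j + shiftedBound α i j) ∧
      bound α m n - ε ≤ average α u m - average α u n := by
  obtain ⟨f, g, hfg, hval⟩ := exists_dual_potentials
    (fun i : Fin (m + 1) => weight α m i) (fun j : Fin (n + 1) => weight α n j)
    (fun i j => shiftedBound α i j) (bound α m n)
    (by
      obtain ⟨z, hz, he⟩ := exists_plan_cost_eq hα m n
      exact ⟨z, hz.1, hz.2.1, hz.2.2, he⟩)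
    (sum_weight α m) (fun z h0 h1 h2 => shiftedBound_le_cost hα ⟨h0, h1, h2⟩) hε
  obtain ⟨j₀, hj₀⟩ := Finite.exists_min g
  -- Inf-convolution merges the pair into one function: `f ≤ U` by the dual constraint, `U ≤ g` by
  -- the zero diagonal, and the triangle inequality makes `U` Lipschitz on all of `ℕ`. Subtracting
  -- the minimum of `g` puts it in `[0,1]`.
  set U : ℕ → ℝ := fun i =>
    Finset.univ.inf' Finset.univ_nonempty fun j : Fin (n + 1) => g j + shiftedBound α i j with hU
  have hUle : ∀ i (j : Fin (n + 1)), U i ≤ g j + shiftedBound α i j := fun i j =>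
    Finset.inf'_le (fun j : Fin (n + 1) => g j + shiftedBound α i j) (Finset.mem_univ j)
  refine ⟨fun i => U i - g j₀, fun i => ⟨?_, ?_⟩, fun i j => ?_, ?_⟩
  · refine sub_nonneg.2 (Finset.le_inf' _ _ fun j _ => ?_)
    linarith [hj₀ j, (shiftedBound_mem_Icc hα i j).1]
  · linarith [hUle i j₀, (shiftedBound_mem_Icc hα i j₀).2]
  · have : U i - shiftedBound α i j ≤ U j := Finset.le_inf' _ _ fun k _ => by
      linarith [hUle i k, shiftedBound_triangle hα i j k]
    linarith
  · have havg : ∀ k, average α (fun i => U i - g j₀) k = average α U k - g j₀ := by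
      intro k
      simp only [average, mul_sub, Finset.sum_sub_distrib, ← Finset.sum_mul, sum_weight, one_mul]
    rw [havg, havg, hval, sub_sub_sub_cancel_right]
    refine sub_le_sub (Finset.sum_le_sum fun i _ => ?_) (Finset.sum_le_sum fun j _ => ?_)
    · exact mul_le_mul_of_nonneg_left (Finset.le_inf' _ _ fun j _ => hfg i j)
        (weight_nonneg hα _ _)
    · refine mul_le_mul_of_nonneg_left ?_ (weight_nonneg hα _ _)
      simpa [shiftedBound_self hα] using hUle j j

/-- Averages of a function that is `1`-Lipschitz for the recursive distance. -/
theorem average_sub_le (hα : ∀ n : ℕ, 1 ≤ n → α n ∈ Set.Ioo (0 : ℝ) 1) {u : ℕ → ℝ}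
    (hu : ∀ i j, u i ≤ u j + shiftedBound α i j) (m n : ℕ) :
    average α u m - average α u n ≤ bound α m n := by
  obtain ⟨z, hz, he⟩ := exists_plan_cost_eq hα m n
  have h1 : average α u m = ∑ i, ∑ j, z i j * u i :=
    Finset.sum_congr rfl fun i _ => by rw [← Finset.sum_mul, hz.2.1]
  have h2 : average α u n = ∑ i, ∑ j, z i j * u j := by
    rw [Finset.sum_comm]
    exact Finset.sum_congr rfl fun j _ => by rw [← Finset.sum_mul, hz.2.2]
  rw [bound, ← he, h1, h2, sub_le_iff_le_add', cost, ← Finset.sum_add_distrib]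
  refine Finset.sum_le_sum fun i _ => ?_
  rw [← Finset.sum_add_distrib]
  refine Finset.sum_le_sum fun j _ => ?_
  rw [← mul_add]
  exact mul_le_mul_of_nonneg_left (hu i j) (hz.1 i j)

theorem average_mem_Icc (hα : ∀ n : ℕ, 1 ≤ n → α n ∈ Set.Ioo (0 : ℝ) 1) {u : ℕ → ℝ}
    (hu : ∀ i, u i ∈ Set.Icc (0 : ℝ) 1) (n : ℕ) : average α u n ∈ Set.Icc (0 : ℝ) 1 := by
  refine ⟨Finset.sum_nonneg fun i _ => mul_nonneg (weight_nonneg hα _ _) (hu i).1, ?_⟩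
  rw [← sum_weight α n]
  exact Finset.sum_le_sum fun i _ => mul_le_of_le_one_right (weight_nonneg hα _ _) (hu i).2

end Potential

/-! ### The unit cube and extension of nonexpansive maps. -/

section Cube

/-- The point of the unit cube with given coordinates. -/
def cubePoint (v : ℕ → ℝ) (hv : ∀ k, v k ∈ Set.Icc (0 : ℝ) 1) : unitCube :=
  ⟨⟨v, memℓp_infty ⟨1, by
    rintro _ ⟨k, rfl⟩
    exact abs_le.2 ⟨by linarith [(hv k).1], (hv k).2⟩⟩⟩, hv⟩

@[simp]
theorem cubePoint_apply (v : ℕ → ℝ) (hv : ∀ k, v k ∈ Set.Icc (0 : ℝ) 1) (k : ℕ) :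
    (cubePoint v hv : lp (fun _ : ℕ => ℝ) ∞) k = v k := rfl

theorem norm_sub_le_of_forall {x y : lp (fun _ : ℕ => ℝ) ∞} {r : ℝ} (hr : 0 ≤ r)
    (hxy : ∀ k, x k - y k ≤ r) (hyx : ∀ k, y k - x k ≤ r) : ‖x - y‖ ≤ r := by
  refine lp.norm_le_of_forall_le hr fun k => ?_
  rw [lp.coeFn_sub, Pi.sub_apply, Real.norm_eq_abs]
  exact abs_le.2 ⟨by linarith [hyx k], hxy k⟩

theorem sub_le_norm_sub (x y : lp (fun _ : ℕ => ℝ) ∞) (k : ℕ) : x k - y k ≤ ‖x - y‖ := by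
  refine (le_abs_self _).trans ?_
  have := lp.norm_apply_le_norm ENNReal.top_ne_zero (x - y) k
  rwa [lp.coeFn_sub, Pi.sub_apply, Real.norm_eq_abs] at this

/-- A map prescribed on a sequence of points of the cube, nonexpansive there, extends to a
nonexpansive self-map of the cube. -/
theorem exists_nonexpansive_extension (x y : ℕ → unitCube)
    (hxy : ∀ m n, ‖(y m : lp (fun _ : ℕ => ℝ) ∞) - (y n : lp (fun _ : ℕ => ℝ) ∞)‖ ≤
      ‖(x m : lp (fun _ : ℕ => ℝ) ∞) - (x n : lp (fun _ : ℕ => ℝ) ∞)‖) :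
    ∃ T : unitCube → unitCube, Nonexpansive T ∧ ∀ n, T (x n) = y n := by
  -- McShane's formula in each coordinate; it is nonnegative, so truncating at `1` lands in the cube
  -- without increasing distances.
  let G : lp (fun _ : ℕ => ℝ) ∞ → ℕ → ℝ := fun p k =>
    ⨅ m, ((y m : lp (fun _ : ℕ => ℝ) ∞) k + ‖p - (x m : lp (fun _ : ℕ => ℝ) ∞)‖)
  have hnn : ∀ p k m, 0 ≤ (y m : lp (fun _ : ℕ => ℝ) ∞) k +
      ‖p - (x m : lp (fun _ : ℕ => ℝ) ∞)‖ := fun p k m =>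
    add_nonneg ((y m).2 k).1 (norm_nonneg _)
  have hGle : ∀ p k m, G p k ≤ (y m : lp (fun _ : ℕ => ℝ) ∞) k +
      ‖p - (x m : lp (fun _ : ℕ => ℝ) ∞)‖ := fun p k m =>
    ciInf_le ⟨0, by rintro _ ⟨m, rfl⟩; exact hnn p k m⟩ m
  have hGlip : ∀ p q k, G p k ≤ G q k + ‖p - q‖ := by
    intro p q k
    rw [← sub_le_iff_le_add]
    refine le_ciInf fun m => ?_
    linarith [hGle p k m, norm_sub_le_norm_sub_add_norm_sub p q
      (x m : lp (fun _ : ℕ => ℝ) ∞)]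
  have hmin : ∀ p q k, min 1 (G p k) - min 1 (G q k) ≤ ‖p - q‖ := by
    intro p q k
    rw [sub_le_iff_le_add', ← min_add_add_right]
    exact min_le_min (by linarith [norm_nonneg (p - q)]) (hGlip p q k)
  refine ⟨fun p => cubePoint (fun k => min 1 (G p k))
    fun k => ⟨le_min zero_le_one (le_ciInf (hnn p k)), min_le_left _ _⟩, fun p q => ?_,
    fun n => ?_⟩
  · refine norm_sub_le_of_forall (norm_nonneg _) (fun k => hmin p q k) fun k => ?_
    rw [norm_sub_rev]
    exact hmin q p k
  · refine Subtype.ext (lp.ext (funext fun k => ?_))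
    have h : G (x n) k = (y n : lp (fun _ : ℕ => ℝ) ∞) k := by
      refine le_antisymm (by simpa using hGle (x n) k n) (le_ciInf fun m => ?_)
      linarith [hxy n m, sub_le_norm_sub (y n : lp (fun _ : ℕ => ℝ) ∞) (y m) k]
    change min 1 (G (x n) k) = _
    rw [h]
    exact min_eq_right ((y n).2 k).2

end Cube

end KM

end

/-! ### Assembly of the orbit and the map. -/

theorem theorem3 (α : ℕ → ℝ) (hα : ∀ n : ℕ, 1 ≤ n → α n ∈ Set.Ioo (0 : ℝ) 1) :
    ∃ (T : KM.unitCube → KM.unitCube) (x : ℕ → KM.unitCube),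
      KM.Nonexpansive T ∧ KM.IsKMSequence α T x ∧
      ∀ m n : ℕ,
        ‖(x m : lp (fun _ : ℕ => ℝ) ∞) - (x n : lp (fun _ : ℕ => ℝ) ∞)‖
          = KM.bound α m n := by
  choose u hu01 hulip huval using fun q : ℕ × ℕ × ℕ =>
    KM.exists_potential hα q.1 q.2.1 (Nat.one_div_pos_of_nat (α := ℝ) (n := q.2.2))
  let e : ℕ ≃ ℕ × ℕ × ℕ := (Denumerable.eqv (ℕ × ℕ × ℕ)).symm
  let x : ℕ → KM.unitCube := fun n => KM.cubePoint (fun k => KM.average α (u (e k)) n)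
    fun k => KM.average_mem_Icc hα (hu01 (e k)) n
  -- These are the future values `T (x n)`. The shift to `n + 1` fits both `average_succ` and `bound
  -- α m n = shiftedBound α (m + 1) (n + 1)`.
  let y : ℕ → KM.unitCube := fun n => KM.cubePoint (fun k => u (e k) (n + 1))
    fun k => hu01 (e k) (n + 1)
  have hbound : ∀ m n, KM.bound α m n = KM.bound α n m := fun m n =>
    KM.shiftedBound_comm hα (m + 1) (n + 1)
  have hnorm : ∀ m n : ℕ,
      ‖(x m : lp (fun _ : ℕ => ℝ) ∞) - (x n : lp (fun _ : ℕ => ℝ) ∞)‖ = KM.bound α m n := by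
    intro m n
    refine le_antisymm (KM.norm_sub_le_of_forall (KM.shiftedBound_mem_Icc hα _ _).1
      (fun k => KM.average_sub_le hα (hulip (e k)) m n) fun k => ?_) ?_
    · rw [hbound]
      exact KM.average_sub_le hα (hulip (e k)) n m
    · refine le_of_forall_pos_sub_le fun ε hε => ?_
      obtain ⟨k, hk⟩ := exists_nat_one_div_lt hε
      have h := KM.sub_le_norm_sub (x m : lp (fun _ : ℕ => ℝ) ∞) (x n) (e.symm (m, n, k))
      have h' := huval (m, n, k)
      simp only [x, KM.cubePoint_apply, Equiv.apply_symm_apply] at h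
      linarith
  obtain ⟨T, hT, hTx⟩ := KM.exists_nonexpansive_extension x y fun m n => by
    rw [hnorm]
    refine KM.norm_sub_le_of_forall (KM.shiftedBound_mem_Icc hα _ _).1 (fun k => ?_) fun k => ?_
    · exact sub_le_iff_le_add'.2 (hulip (e k) (m + 1) (n + 1))
    · rw [hbound]
      exact sub_le_iff_le_add'.2 (hulip (e k) (n + 1) (m + 1))
  refine ⟨T, x, hT, fun n => lp.ext (funext fun k => ?_), hnorm⟩
  rw [hTx]
  exact KM.average_succ α (u (e k)) n
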